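/- Let $X$ be an infinite-dimensional (real) Banach space, and let $$\kappa(X)=\sup\Big\{\inf_{n\neq m}\|x_n-x_m\| : (x_n)_{n\in\mathbb N}\subset X,\ \|x_n\|\le 1\ \text{for all } n\Big\}$$ be its Kottman constant. Let $c_0$ be the Banach space of real null sequences with the supremum norm. For $\alpha\in(0,1]$, a map $f$ between metric spaces is called $\alpha$-Hölder if $$\operatorname{Lip}_\alpha(f)=\sup_{x\ne y}\frac{d(f(x),f(y))}{d(x,y)^{\alpha}}<\infty .$$ For $C\geq 1$ let $\mathcal B_C(X,c_0)$ be the set of those $\alpha\in(0,1]$ such that, for every subset $M\subseteq X$, every $\alpha$-Hölder map $f:M\to c_0$ has an extension $F:X\to c_0$ with $\operatorname{Lip}_\alpha(F)\le C\operatorname{Lip}_\alpha(f)$. Then $\kappa(X)>1$, $$\mathcal B_C(X,c_0)=\left(0,\frac{\log C}{\log\kappa(X)}\right]\qquad\text{for all } 1\le C\le\kappa(X),$$ and $$\mathcal B_{\kappa(X)^{\alpha}}(X,c_0)=(0,\alpha]\qquad\text{for all } \alpha\in(0,1].$$ (For $C=1$ the interval is empty.) -/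

import Mathlib

open scoped ZeroAtInfty

/-- The separation `inf_{n ≠ m} ‖x n - x m‖` of a sequence. -/
noncomputable def seqSep {X : Type*} [NormedAddCommGroup X] (x : ℕ → X) : ℝ :=
  ⨅ p : {p : ℕ × ℕ // p.1 ≠ p.2}, ‖x p.1.1 - x p.1.2‖

/-- The separations of all sequences in the closed unit ball. -/
def unitBallSeps (X : Type*) [NormedAddCommGroup X] : Set ℝ :=
  {s : ℝ | ∃ x : ℕ → X, (∀ n, ‖x n‖ ≤ 1) ∧ s = seqSep x}

/-- The Kottman constant: the supremum of the separations of sequences in the unit ball. -/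
noncomputable def kottman (X : Type*) [NormedAddCommGroup X] : ℝ :=
  sSup (unitBallSeps X)

/-- The set of exponents `α ∈ (0, 1]` such that every `α`-Hölder map `f` from a subset of `X` to
`Y` extends to a map `F` on `X` with `Lip_α F ≤ C * Lip_α f`. Mathlib's `eHolderNorm α f` is
the least `α`-Hölder constant `Lip_α f` of `f`, as an extended nonnegative real. -/
def holderExtExponents (X Y : Type*) [MetricSpace X] [MetricSpace Y] (C : ℝ) : Set ℝ :=
  {α : ℝ | 0 < α ∧ α ≤ 1 ∧
    ∀ (M : Set X) (f : M → Y), MemHolder α.toNNReal f →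
      ∃ F : X → Y, (∀ x : M, F x = f x) ∧
        eHolderNorm α.toNNReal F ≤ ENNReal.ofReal C * eHolderNorm α.toNNReal f}

/-- The infimum in `seqSep` is over a set bounded below. -/
theorem seqSep_bddBelow {X : Type*} [NormedAddCommGroup X] (x : ℕ → X) :
    BddBelow (Set.range fun p : {p : ℕ × ℕ // p.1 ≠ p.2} => ‖x p.1.1 - x p.1.2‖) :=
  ⟨0, by rintro _ ⟨p, rfl⟩; exact norm_nonneg _⟩

/-- The supremum in `kottman` is over a nonempty set. -/
theorem unitBallSeps_nonempty (X : Type*) [NormedAddCommGroup X] : (unitBallSeps X).Nonempty :=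
  ⟨_, fun _ => 0, by simp, rfl⟩

/-- The supremum in `kottman` is over a set bounded above. -/
theorem unitBallSeps_bddAbove (X : Type*) [NormedAddCommGroup X] : BddAbove (unitBallSeps X) := by
  refine ⟨2, ?_⟩
  rintro _ ⟨x, hx, rfl⟩
  refine (ciInf_le (seqSep_bddBelow x) ⟨(0, 1), by simp⟩).trans ?_
  have h := norm_sub_le (x 0) (x 1)
  have h0 := hx 0
  have h1 := hx 1
  simp only
  linarith

namespace Kottman

open Filter Topology

/-! ### Separated sequences in a ball. -/

section Separation

variable {X : Type*} [NormedAddCommGroup X] [NormedSpace ℝ X]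

/-! Write κ for the Kottman constant. Everything reduces to: α is admissible for C iff κ^α ≤ C
(`mem_holderExtExponents_iff`). Necessity: send an s-separated sequence of the unit ball to s^α e_n;
an extension has a null sequence as its value at 0, which forces s^α ≤ C. Sufficiency: extend each
coordinate by the median of 0 and the two McShane–Whitney envelopes. If the values at x were not
null, M would contain a sequence too separated relative to its distances from x
(`not_exists_seq_gap`).

That κ > 1 is the Elton–Odell theorem. Suppose κ ≤ 1. Ultrafilters serve as laws of random vectors
and `bind` as successive sampling. A walk with bounded weakly null increments then fails to exit
some ball almost surely (`exists_not_exits`). Increments bounded below in norm thus give a sequence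
with bounded subset sums (`exists_seq_bounded_sums`), and its signed sums contain a sequence showing
κ ≥ 1.6 (`one_lt_kottman_of_tails`). -/

theorem kottman_nonneg (X : Type*) [NormedAddCommGroup X] : 0 ≤ kottman X := by
  refine Real.sSup_nonneg ?_
  rintro _ ⟨x, _, rfl⟩
  exact Real.iInf_nonneg fun _ => norm_nonneg _

/-- A `c`-separated sequence in the ball of radius `b` has `c ≤ kottman X * b`. -/
theorem le_kottman_mul_of_separated {b c : ℝ} (hb : 0 < b) {y : ℕ → X} (hy : ∀ n, ‖y n‖ ≤ b)
    (hsep : ∀ m n, m < n → c ≤ ‖y m - y n‖) : c ≤ kottman X * b := by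
  have hsep' : ∀ m n, m ≠ n → c ≤ ‖y m - y n‖ := by
    intro m n hmn
    rcases lt_or_gt_of_ne hmn with h | h
    · exact hsep m n h
    · rw [norm_sub_rev]
      exact hsep n m h
  have : Nonempty {p : ℕ × ℕ // p.1 ≠ p.2} := ⟨⟨(0, 1), by simp⟩⟩
  have h1 : c / b ≤ seqSep (fun n => b⁻¹ • y n) := by
    refine le_ciInf fun p => ?_
    rw [← smul_sub, norm_smul, norm_inv, Real.norm_of_nonneg hb.le, div_eq_inv_mul]
    exact mul_le_mul_of_nonneg_left (hsep' _ _ p.2) (inv_nonneg.2 hb.le)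
  have h2 : seqSep (fun n => b⁻¹ • y n) ≤ kottman X := by
    refine le_csSup (unitBallSeps_bddAbove X) ⟨_, fun n => ?_, rfl⟩
    rw [norm_smul, norm_inv, Real.norm_of_nonneg hb.le, ← div_eq_inv_mul]
    exact (div_le_one hb).2 (hy n)
  exact (div_le_iff₀ hb).1 (h1.trans h2)

/-- Sample from `q` recursively: each new vector has to satisfy only finitely many almost sure
conditions, one for each earlier vector. -/
theorem le_kottman_mul_of_eventually {q : Filter X} [q.NeBot] {b c : ℝ} (hb : 0 < b)
    (hq : ∀ᶠ y in q, ‖y‖ ≤ b) (hc : ∀ᶠ y in q, ∀ᶠ y' in q, c ≤ ‖y - y'‖) :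
    c ≤ kottman X * b := by
  obtain ⟨f, hf, hf'⟩ := exists_seq_of_forall_finset_exists
    (fun y : X => ‖y‖ ≤ b ∧ ∀ᶠ y' in q, c ≤ ‖y - y'‖) (fun y y' => c ≤ ‖y - y'‖) (by
      intro s hs
      have h : ∀ᶠ y' in q, ∀ x ∈ s, c ≤ ‖x - y'‖ :=
        (eventually_all_finset s).2 fun x hx => (hs x hx).2
      exact ((hq.and hc).and h).exists)
  exact le_kottman_mul_of_separated hb (fun n => (hf n).1) hf'

end Separation

/-! ### Laws along which convex functions do not drop. -/

section Drop

variable {X : Type*} [NormedAddCommGroup X] [NormedSpace ℝ X]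

/-- Convex continuous functions are lower semicontinuous along the filter `q` at `x`. -/
def DropTo (q : Filter X) (x : X) : Prop :=
  ∀ g : X → ℝ, ConvexOn ℝ Set.univ g → Continuous g → ∀ c, c < g x → ∀ᶠ y in q, c < g y

/-- Hahn–Banach separates `x` strictly from the closed convex sublevel set, and weak convergence
keeps `q` on the side of `x`. -/
theorem dropTo_of_weak {q : Filter X} {x : X}
    (h : ∀ f : X →L[ℝ] ℝ, Tendsto f q (𝓝 (f x))) : DropTo q x := by
  intro g hg hgc c hc
  have hconv : Convex ℝ {y | g y ≤ c} := by simpa using hg.convex_le c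
  obtain ⟨f, u, hfu, hf⟩ := geometric_hahn_banach_point_closed hconv
    (isClosed_le hgc continuous_const) (by simpa using hc : x ∉ {y | g y ≤ c})
  filter_upwards [(h f).eventually (gt_mem_nhds hfu)] with y hy
  by_contra! hcon
  exact absurd (hf y hcon) (not_lt.2 hy.le)

theorem dropTo_pure (x : X) : DropTo (pure x) x := fun _ _ _ _ hc => hc

theorem convexOn_comp_add {g : X → ℝ} (hg : ConvexOn ℝ Set.univ g) (x : X) :
    ConvexOn ℝ Set.univ fun z => g (x + z) := by
  simpa [Function.comp_def] using hg.translate_right x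

theorem convexOn_comp_neg {g : X → ℝ} (hg : ConvexOn ℝ Set.univ g) :
    ConvexOn ℝ Set.univ fun z => g (-z) := by
  simpa [Function.comp_def] using hg.comp_linearMap (-LinearMap.id : X →ₗ[ℝ] X)

/-- Dropping a random increment and then a random continuation. -/
theorem DropTo.bind {V : Filter X} (hV : DropTo V 0) {x : X} {q : X → Filter X}
    (hq : ∀ᶠ z in V, DropTo (q z) (x + z)) : DropTo (V.bind q) x := by
  intro g hg hgc c hc
  rw [eventually_bind]
  have := hV (fun z => g (x + z)) (convexOn_comp_add hg x) (by fun_prop) c (by simpa using hc)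
  filter_upwards [this, hq] with z hz hqz
  exact hqz g hg hgc c hz

/-- The limit of `‖v + y‖` along a bounded ultrafilter is convex and continuous in `v`. -/
theorem exists_limit_norm_add (q : Ultrafilter X) {b : ℝ} (hq : ∀ᶠ y in (q : Filter X), ‖y‖ ≤ b) :
    ∃ φ : X → ℝ, ConvexOn ℝ Set.univ φ ∧ Continuous φ ∧
      ∀ v, Tendsto (fun y => ‖v + y‖) q (𝓝 (φ v)) := by
  have hex : ∀ v, ∃ a, Tendsto (fun y => ‖v + y‖) (q : Filter X) (𝓝 a) := by
    intro v
    obtain ⟨a, -, ha⟩ := (isCompact_Icc (a := (0 : ℝ)) (b := ‖v‖ + b)).ultrafilter_le_nhds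
      (q.map fun y => ‖v + y‖) (by
        rw [le_principal_iff]
        change ∀ᶠ y in (q : Filter X), ‖v + y‖ ∈ Set.Icc (0 : ℝ) (‖v‖ + b)
        filter_upwards [hq] with y hy
        exact ⟨norm_nonneg _, (norm_add_le _ _).trans (by linarith)⟩)
    exact ⟨a, ha⟩
  choose φ hφ using hex
  refine ⟨φ, ⟨convex_univ, ?_⟩, ?_, hφ⟩
  · intro v _ w _ s t hs ht hst
    refine le_of_tendsto_of_tendsto' (hφ _)
      (((hφ v).const_mul s).add ((hφ w).const_mul t)) fun y => ?_
    have : s • v + t • w + y = s • (v + y) + t • (w + y) := by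
      rw [smul_add, smul_add, add_add_add_comm, ← add_smul, hst, one_smul]
    rw [this]
    refine (norm_add_le _ _).trans ?_
    rw [norm_smul, norm_smul, Real.norm_of_nonneg hs, Real.norm_of_nonneg ht]
  · refine LipschitzWith.continuous (K := 1) (LipschitzWith.of_le_add fun v w => ?_)
    refine le_of_tendsto_of_tendsto' (hφ v) ((hφ w).add_const _) fun y => ?_
    rw [dist_eq_norm]
    have : v + y = (w + y) + (v - w) := by abel
    rw [this]
    exact norm_add_le _ _

theorem eventually_bind_ultrafilter {α β : Type*} {V : Ultrafilter α} {q : α → Ultrafilter β}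
    {p : β → Prop} : (∀ᶠ y in (V.bind q : Filter β), p y) ↔
      ∀ᶠ x in (V : Filter α), ∀ᶠ y in (q x : Filter β), p y := Iff.rfl

/-- If the Kottman constant is at most one, two independent copies of a bounded weakly null
ultrafilter have a sum that is no larger than each of them. -/
theorem le_of_eventually_le_norm_add (hκ : kottman X ≤ 1) {q : Ultrafilter X}
    (hq0 : DropTo (q : Filter X) 0) {b c : ℝ} (hb : 0 < b)
    (hq : ∀ᶠ y in (q : Filter X), ‖y‖ ≤ b)
    (hc : ∀ᶠ y in (q : Filter X), ∀ᶠ y' in (q : Filter X), c < ‖y + y'‖) : c ≤ b := by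
  by_contra! hbc
  obtain ⟨φ, hφ, hφc, hφl⟩ := exists_limit_norm_add q hq
  obtain ⟨c₁, hbc₁, hc₁⟩ := exists_between hbc
  obtain ⟨c₂, hbc₂, hc₂⟩ := exists_between hbc₁
  -- Inserting `-y₂` and `-y₃` between the two summands does not lower the norm, by weak nullity;
  -- regrouping gives two independent differences.
  have key : ∀ᶠ y₁ in (q : Filter X), ∀ᶠ y₂ in (q : Filter X), ∀ᶠ y₃ in (q : Filter X),
      ∀ᶠ y₄ in (q : Filter X), c₁ < ‖(y₁ - y₂) - (y₃ - y₄)‖ := by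
    filter_upwards [hc] with y₁ h₁
    have h0 : c₁ < φ y₁ := hc₁.trans_le (ge_of_tendsto (hφl y₁) (h₁.mono fun _ h => h.le))
    have h2 := hq0 (fun y => φ (y₁ + -y)) (convexOn_comp_neg (convexOn_comp_add hφ y₁))
      (by fun_prop) c₁ (by simpa using h0)
    filter_upwards [h2] with y₂ h₂
    have h3 := hq0 (fun y => φ (y₁ + -y₂ + -y))
      (convexOn_comp_neg (convexOn_comp_add hφ (y₁ + -y₂))) (by fun_prop) c₁ (by simpa using h₂)
    filter_upwards [h3] with y₃ h₃
    filter_upwards [(hφl (y₁ + -y₂ + -y₃)).eventually (lt_mem_nhds h₃)] with y₄ h₄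
    have : (y₁ - y₂) - (y₃ - y₄) = y₁ + -y₂ + -y₃ + y₄ := by abel
    rwa [this]
  let w : Ultrafilter X := q.bind fun y => q.map fun y' => y - y'
  have hw : ∀ p : X → Prop, (∀ᶠ x in (w : Filter X), p x) ↔
      ∀ᶠ y in (q : Filter X), ∀ᶠ y' in (q : Filter X), p (y - y') := fun p => Iff.rfl
  -- Either the differences lie in the ball of radius `c₂ < c₁` and are `c₁`-separated, or copies of
  -- `q` in the ball of radius `b < c₂` are `c₂`-separated.
  by_cases hwb : ∀ᶠ x in (w : Filter X), ‖x‖ ≤ c₂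
  · have h : c₁ ≤ kottman X * c₂ := by
      refine le_kottman_mul_of_eventually (hb.trans hbc₂) hwb ?_
      simp only [hw]
      exact key.mono fun _ h => h.mono fun _ h => h.mono fun _ h => h.mono fun _ h => h.le
    nlinarith
  · rw [← Ultrafilter.eventually_not, hw] at hwb
    have h : c₂ ≤ kottman X * b := by
      refine le_kottman_mul_of_eventually hb hq ?_
      exact hwb.mono fun _ h => h.mono fun _ h => (not_le.1 h).le
    nlinarith

end Drop

/-! ### The random walk and its exit from balls. -/

section Walk

variable {X : Type*} [NormedAddCommGroup X]

/-- Almost surely, the walk from `x` with independent increments of law `V` leaves the ball of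
radius `L`. -/
inductive Exits (V : Filter X) (L : ℝ) : X → Prop
  | out {x : X} : L < ‖x‖ → Exits V L x
  | step {x : X} (A : Set X) : A ∈ V → (∀ z ∈ A, Exits V L (x + z)) → Exits V L x

/-- Almost surely, for the walk started at `y`, the walk translated by `d` leaves the ball of
radius `L` strictly before the walk itself leaves the ball of radius `L'`. -/
inductive ExitsBefore (V : Filter X) (L L' : ℝ) (d : X) : X → Prop
  | out {y : X} : ‖y‖ ≤ L' → L < ‖d + y‖ → ExitsBefore V L L' d y
  | step {y : X} (A : Set X) : ‖y‖ ≤ L' → A ∈ V → (∀ z ∈ A, ExitsBefore V L L' d (y + z)) →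
      ExitsBefore V L L' d y

theorem Exits.of_eventually {V : Filter X} {L : ℝ} {x : X} (h : ∀ᶠ z in V, Exits V L (x + z)) :
    Exits V L x := .step _ h fun _ hz => hz

theorem ExitsBefore.of_eventually {V : Filter X} {L L' : ℝ} {d y : X} (hy : ‖y‖ ≤ L')
    (h : ∀ᶠ z in V, ExitsBefore V L L' d (y + z)) : ExitsBefore V L L' d y :=
  .step _ hy h fun _ hz => hz

theorem ExitsBefore.norm_le {V : Filter X} {L L' : ℝ} {d y : X} (h : ExitsBefore V L L' d y) :
    ‖y‖ ≤ L' := by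
  cases h <;> assumption

/-- `Chain V L k x` says that `x = z + (z' + (z'' + ⋯))`, where no head translates the walk of its
tail out of the next larger ball of the decreasing sequence `L` of radii too early. -/
inductive Chain (V : Filter X) (L : ℕ → ℝ) : ℕ → X → Prop
  | zero (k : ℕ) : Chain V L k 0
  | cons {k : ℕ} {z s : X} : Chain V L (k + 1) s → ‖s‖ ≤ L (k + 1) →
      ¬ ExitsBefore V (L k) (L (k + 1)) z s → Chain V L k (z + s)

/-- A new increment is added to the innermost tail and starts a new link there. For each older head
the tail stays in its ball, so a sum outside the next larger ball would be an early exit. -/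
theorem Chain.eventually {V : Ultrafilter X} (hV1 : ∀ᶠ z in (V : Filter X), ‖z‖ ≤ 1) {L : ℕ → ℝ}
    (hL1 : ∀ k, 1 ≤ L k)
    (hL : ∀ k, ∀ᶠ d in (V : Filter X), ¬ ExitsBefore (V : Filter X) (L k) (L (k + 1)) d 0)
    {k : ℕ} {x : X} (hx : Chain (V : Filter X) L k x) :
    ∀ᶠ z in (V : Filter X), Chain (V : Filter X) L k (x + z) ∧ ‖x + z‖ ≤ L k := by
  induction hx with
  | zero k =>
    filter_upwards [hV1, hL k] with z hz hz'
    refine ⟨?_, by simpa using hz.trans (hL1 k)⟩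
    have := Chain.cons (Chain.zero (k + 1)) (by simpa using zero_le_one.trans (hL1 (k + 1))) hz'
    rwa [add_zero, ← zero_add z] at this
  | @cons k z s _ hs hE ih =>
    have hE' : ∀ᶠ w in (V : Filter X),
        ¬ ExitsBefore (V : Filter X) (L k) (L (k + 1)) z (s + w) := by
      rw [Ultrafilter.eventually_not]
      exact fun h => hE (.of_eventually hs h)
    filter_upwards [ih, hE'] with w hw hw'
    rw [add_assoc]
    refine ⟨.cons hw.1 hw.2 hw', ?_⟩
    by_contra! h
    exact hw' (.out hw.2 h)

variable [NormedSpace ℝ X]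

/-- The law of the position of the walk just before it leaves the ball of radius `L'`. -/
theorem Exits.exists_law {V : Ultrafilter X} (hV : DropTo (V : Filter X) 0) {L' : ℝ} {x : X}
    (hx : Exits (V : Filter X) L' x) (hxL : ‖x‖ ≤ L') :
    ∃ q : Ultrafilter X, DropTo (q : Filter X) x ∧ (∀ᶠ y in (q : Filter X), ‖y‖ ≤ L') ∧
      ∀ L d, ExitsBefore (V : Filter X) L L' d x → ∀ c < L, ∀ᶠ y in (q : Filter X), c < ‖d + y‖ := by
  induction hx with
  | out h => exact absurd h (not_lt.2 hxL)
  | @step x A hA _ ih =>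
    by_cases hcase : ∀ᶠ z in (V : Filter X), ‖x + z‖ ≤ L'
    · have hgood : ∀ᶠ z in (V : Filter X), ∃ q : Ultrafilter X,
          DropTo (q : Filter X) (x + z) ∧ (∀ᶠ y in (q : Filter X), ‖y‖ ≤ L') ∧
          ∀ L d, ExitsBefore (V : Filter X) L L' d (x + z) → ∀ c < L,
            ∀ᶠ y in (q : Filter X), c < ‖d + y‖ := by
        filter_upwards [hA, hcase] with z hz hz'
        exact ih z hz hz'
      choose! q hq using fun z (hz : ∃ q : Ultrafilter X,
          DropTo (q : Filter X) (x + z) ∧ (∀ᶠ y in (q : Filter X), ‖y‖ ≤ L') ∧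
          ∀ L d, ExitsBefore (V : Filter X) L L' d (x + z) → ∀ c < L,
            ∀ᶠ y in (q : Filter X), c < ‖d + y‖) => hz
      refine ⟨V.bind q, ?_, ?_, ?_⟩
      · exact hV.bind (q := fun z => (q z : Filter X)) (hgood.mono fun z hz => (hq z hz).1)
      · rw [eventually_bind_ultrafilter]
        exact hgood.mono fun z hz => (hq z hz).2.1
      · intro L d hE c hc
        rw [eventually_bind_ultrafilter]
        cases hE with
        | out _ h2 =>
          -- The translated walk is already outside; by convexity the remaining increments keep its
          -- norm above `c`.
          have hd := hV (fun z => ‖d + x + z‖)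
            (convexOn_comp_add (convexOn_norm convex_univ) (d + x)) (by fun_prop) c
            (by simpa using hc.trans h2)
          filter_upwards [hd, hgood] with z hz hz'
          refine (hq z hz').1 (fun y => ‖d + y‖)
            (convexOn_comp_add (convexOn_norm convex_univ) d) (by fun_prop) c ?_
          rwa [← add_assoc]
        | step B _ hB h2 =>
          filter_upwards [hB, hgood] with z hz hz'
          exact (hq z hz').2.2 L d (h2 z hz) c hc
    -- The next step almost surely leaves the ball, so the walk stops at `x`. An early exit must
    -- then have happened already, since `step` needs the next position inside.
    · refine ⟨pure x, dropTo_pure x, hxL, ?_⟩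
      intro L d hE c hc
      cases hE with
      | out _ h2 => exact hc.trans h2
      | step B _ hB h2 => exact absurd (mem_of_superset hB fun z hz => (h2 z hz).norm_le) hcase

/-- If the Kottman constant is at most one, a single first increment does not make the walk leave
a larger ball earlier. -/
theorem eventually_not_exitsBefore (hκ : kottman X ≤ 1) {V : Ultrafilter X}
    (hV : DropTo (V : Filter X) 0) (hV1 : ∀ᶠ z in (V : Filter X), ‖z‖ ≤ 1) {L L' : ℝ}
    (h1 : 1 ≤ L') (hL : L' < L) (hexit : Exits (V : Filter X) L' 0) :
    ∀ᶠ d in (V : Filter X), ¬ ExitsBefore (V : Filter X) L L' d 0 := by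
  rw [Ultrafilter.eventually_not]
  intro hE
  have hstart : ∀ᶠ z in (V : Filter X), Exits (V : Filter X) L' z := by
    cases hexit with
    | out h => rw [norm_zero] at h; linarith
    | step A hA h => exact mem_of_superset hA fun z hz => by simpa using h z hz
  -- The first increment is sampled separately, so that lower bounds on convex functions pass from
  -- `V` to the stopped law `q`.
  obtain ⟨q, hq0, hqb, hqE, hqφ⟩ : ∃ q : Ultrafilter X, DropTo (q : Filter X) 0 ∧
      (∀ᶠ y in (q : Filter X), ‖y‖ ≤ L') ∧
      (∀ᶠ d in (V : Filter X), ∀ c < L, ∀ᶠ y in (q : Filter X), c < ‖d + y‖) ∧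
      ∀ φ : X → ℝ, ConvexOn ℝ Set.univ φ → Continuous φ → ∀ c,
        (∀ᶠ d in (V : Filter X), c < φ d) → ∀ᶠ y in (q : Filter X), c < φ y := by
    have hgood : ∀ᶠ z in (V : Filter X), ∃ r : Ultrafilter X, DropTo (r : Filter X) z ∧
        (∀ᶠ y in (r : Filter X), ‖y‖ ≤ L') ∧
        ∀ L d, ExitsBefore (V : Filter X) L L' d z → ∀ c < L,
          ∀ᶠ y in (r : Filter X), c < ‖d + y‖ := by
      filter_upwards [hstart, hV1] with z hz hz'
      exact hz.exists_law hV (hz'.trans h1)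
    choose! r hr using fun z (hz : ∃ r : Ultrafilter X, DropTo (r : Filter X) z ∧
        (∀ᶠ y in (r : Filter X), ‖y‖ ≤ L') ∧
        ∀ L d, ExitsBefore (V : Filter X) L L' d z → ∀ c < L,
          ∀ᶠ y in (r : Filter X), c < ‖d + y‖) => hz
    refine ⟨V.bind r, ?_, ?_, ?_, ?_⟩
    · exact hV.bind (q := fun z => (r z : Filter X))
        (hgood.mono fun z hz => by simpa using (hr z hz).1)
    · rw [eventually_bind_ultrafilter]
      exact hgood.mono fun z hz => (hr z hz).2.1
    · filter_upwards [hE, hV1] with d hd hd1 c hc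
      rw [eventually_bind_ultrafilter]
      cases hd with
      | out _ h2 => rw [add_zero] at h2; linarith
      | step B _ hB h2 =>
        filter_upwards [hB, hgood] with z hz hz'
        exact (hr z hz').2.2 L d (by simpa using h2 z hz) c hc
    · intro φ hφ hφc c h
      rw [eventually_bind_ultrafilter]
      filter_upwards [hgood, h] with z hz hz'
      exact (hr z hz).1 φ hφ hφc c hz'
  obtain ⟨φ, hφ, hφc, hφl⟩ := exists_limit_norm_add q hqb
  obtain ⟨c, hLc, hcL⟩ := exists_between hL
  obtain ⟨c', hLc', hc'⟩ := exists_between hLc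
  have hd : ∀ᶠ d in (V : Filter X), c' < φ d := by
    filter_upwards [hqE] with d hd
    exact hc'.trans_le (ge_of_tendsto (hφl d) ((hd c hcL).mono fun _ h => h.le))
  -- The single increment `d` is replaced by a whole independent stopped walk.
  have hsum : ∀ᶠ y in (q : Filter X), ∀ᶠ y' in (q : Filter X), c' < ‖y + y'‖ := by
    filter_upwards [hqφ φ hφ hφc c' hd] with y hy
    exact (hφl y).eventually (lt_mem_nhds hy)
  exact absurd (le_of_eventually_le_norm_add hκ hq0 (by linarith) hqb hsum) (not_le.2 hLc')

/-- If the Kottman constant is at most one, the walk stays bounded with positive probability. -/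
theorem exists_not_exits (hκ : kottman X ≤ 1) {V : Ultrafilter X}
    (hV : DropTo (V : Filter X) 0) (hV1 : ∀ᶠ z in (V : Filter X), ‖z‖ ≤ 1) :
    ∃ L, ¬ Exits (V : Filter X) L 0 := by
  by_contra! hall
  -- Strictly decreasing radii that never fall below the bound 1 on an increment.
  let L : ℕ → ℝ := fun k => 1 + (1 / 2) ^ k
  have hL1 : ∀ k, 1 ≤ L k := fun k => by simp only [L]; linarith [pow_pos (one_half_pos (α := ℝ)) k]
  have hLlt : ∀ k, L (k + 1) < L k := fun k => by
    simp only [L, pow_succ]; linarith [pow_pos (one_half_pos (α := ℝ)) k]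
  have hnot : ∀ x, Exits (V : Filter X) (L 0) x → Chain (V : Filter X) L 0 x → ‖x‖ ≤ L 0 →
      False := by
    intro x hx
    induction hx with
    | out h => exact fun _ h' => absurd h (not_lt.2 h')
    | step A hA _ ih =>
      intro hC _
      have hev := hC.eventually hV1 hL1 fun k =>
        eventually_not_exitsBefore hκ hV hV1 (hL1 (k + 1)) (hLlt k) (hall _)
      obtain ⟨z, hz, hzA⟩ := (hev.and hA).exists
      exact ih z hzA hz.1 hz.2
  exact hnot 0 (hall _) (.zero 0) (by simpa using zero_le_one.trans (hL1 0))

end Walk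

/-! ### From a walk that does not exit to bounded subset sums. -/

section BoundedSums

variable {X : Type*} [NormedAddCommGroup X]

/-- If the walk does not exit, some sequence of increments has bounded subset sums. -/
theorem exists_seq_bounded_sums {V : Ultrafilter X} {L : ℝ}
    (hL : ¬ Exits (V : Filter X) L 0) {p : X → Prop} (hp : ∀ᶠ z in (V : Filter X), p z) :
    ∃ z : ℕ → X, (∀ n, p (z n)) ∧ ∀ F : Finset ℕ, ‖∑ i ∈ F, z i‖ ≤ L := by
  classical
  have hbd : ∀ x, ¬ Exits (V : Filter X) L x → ‖x‖ ≤ L := fun x hx =>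
    not_lt.1 fun h => hx (.out h)
  have hstep : ∀ x, ¬ Exits (V : Filter X) L x →
      ∀ᶠ z in (V : Filter X), ¬ Exits (V : Filter X) L (x + z) := fun x hx => by
    rw [Ultrafilter.eventually_not]
    exact fun h => hx (.of_eventually h)
  have hnext : ∀ A : {A : Finset X // ∀ x ∈ A, ¬ Exits (V : Filter X) L x},
      ∃ z, p z ∧ ∀ x ∈ A.1, ¬ Exits (V : Filter X) L (x + z) := fun A =>
    (hp.and ((eventually_all_finset A.1).2 fun x hx => hstep x (A.2 x hx))).exists
  choose next hnext_p hnext using hnext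
  -- `A n` collects the subset sums of the first `n` increments; the next increment must suit all of
  -- them.
  let A : ℕ → {A : Finset X // ∀ x ∈ A, ¬ Exits (V : Filter X) L x} := fun n =>
    Nat.rec ⟨{0}, by simpa using hL⟩ (fun _ A => ⟨A.1 ∪ A.1.image (· + next A), by
      intro x hx
      rcases Finset.mem_union.1 hx with hx | hx
      · exact A.2 x hx
      · obtain ⟨y, hy, rfl⟩ := Finset.mem_image.1 hx
        exact hnext A y hy⟩) n
  have hA : ∀ n, ∀ F : Finset ℕ, F ⊆ Finset.range n → ∑ i ∈ F, next (A i) ∈ (A n).1 := by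
    intro n
    induction n with
    | zero =>
      intro F hF
      have : F = ∅ := by simpa using hF
      simp [this, A]
    | succ n ih =>
      intro F hF
      have hAn : (A (n + 1)).1 = (A n).1 ∪ (A n).1.image (· + next (A n)) := rfl
      rw [hAn]
      by_cases hn : n ∈ F
      · rw [← Finset.sum_erase_add _ _ hn]
        refine Finset.mem_union_right _ (Finset.mem_image_of_mem (· + next (A n)) (ih _ ?_))
        intro i hi
        have h1 := hF (Finset.mem_of_mem_erase hi)
        have h2 := Finset.ne_of_mem_erase hi
        simp only [Finset.mem_range] at h1 ⊢
        omega
      · refine Finset.mem_union_left _ (ih _ fun i hi => ?_)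
        have h1 := hF hi
        have h2 : i ≠ n := fun h => hn (h ▸ hi)
        simp only [Finset.mem_range] at h1 ⊢
        omega
  refine ⟨fun n => next (A n), fun n => hnext_p _, fun F => ?_⟩
  obtain ⟨n, hn⟩ := F.exists_nat_subset_range
  exact hbd _ ((A n).2 _ (hA n F hn))

end BoundedSums

/-! ### Bounded tail sums force κ > 1. -/

section NullSequences

variable {X : Type*} [NormedAddCommGroup X] [NormedSpace ℝ X]

/-- A decreasing family of bounded sets of tail vectors, stable under adding tails of later tails,
forces the Kottman constant to exceed one. -/
theorem one_lt_kottman_of_tails {S : ℕ → Set X} (hanti : Antitone S)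
    (hneg : ∀ n, ∀ s ∈ S n, -s ∈ S n)
    (hadd : ∀ n, ∀ s ∈ S n, ∃ m, ∀ s' ∈ S m, s + s' ∈ S n)
    {B δ : ℝ} (hB : ∀ s ∈ S 0, ‖s‖ ≤ B) (hδ : 0 < δ) (hbig : ∀ n, ∃ s ∈ S n, δ ≤ ‖s‖) :
    1 < kottman X := by
  have hbdd : ∀ n, BddAbove (norm '' S n) := fun n => by
    refine ⟨B, ?_⟩
    rintro _ ⟨s, hs, rfl⟩
    exact hB s (hanti (Nat.zero_le n) hs)
  let M : ℕ → ℝ := fun n => sSup (norm '' S n)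
  have hMδ : ∀ n, δ ≤ M n := fun n => by
    obtain ⟨s, hs, hs'⟩ := hbig n
    exact hs'.trans (le_csSup (hbdd n) ⟨s, hs, rfl⟩)
  have hMδ' : δ ≤ ⨅ n, M n := le_ciInf hMδ
  have hMbdd : BddBelow (Set.range M) := ⟨δ, by rintro _ ⟨n, rfl⟩; exact hMδ n⟩
  -- Since 10/11 > 9/10, every `S n` then has a vector of norm at least `9 / 10 * μ`.
  obtain ⟨N, hN⟩ := exists_lt_of_ciInf_lt (f := M) (a := 11 / 10 * ⨅ n, M n) (by linarith)
  set μ := M N with hμ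
  have hμ0 : 0 < μ := hδ.trans_le (hMδ N)
  have hle : ∀ s ∈ S N, ‖s‖ ≤ μ := fun s hs => le_csSup (hbdd N) ⟨s, hs, rfl⟩
  have hex : ∀ n, ∃ s ∈ S n, 9 / 10 * μ ≤ ‖s‖ := fun n => by
    obtain ⟨s₀, hs₀, -⟩ := hbig n
    obtain ⟨_, ⟨s, hs, rfl⟩, hs'⟩ := exists_lt_of_lt_csSup (b := 9 / 10 * μ)
      (s := norm '' S n) ⟨_, s₀, hs₀, rfl⟩ (by
        have : (⨅ n, M n) ≤ M n := ciInf_le hMbdd n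
        change _ < M n
        linarith)
    exact ⟨s, hs, hs'.le⟩
  choose big hbigS hbig9 using hex
  choose! next hnext using hadd
  let level : ℕ → ℕ := fun k => Nat.rec N (fun _ n => next n (big n)) k
  let b : ℕ → X := fun k => big (level k)
  have hbS : ∀ k, b k ∈ S (level k) := fun k => hbigS _
  have hb9 : ∀ k, 9 / 10 * μ ≤ ‖b k‖ := fun k => hbig9 _
  have hstep : ∀ k, ∀ s ∈ S (level (k + 1)), b k + s ∈ S (level k) := fun k s hs =>
    hnext _ _ (hbS k) s hs
  have hT : ∀ j k, ∑ i ∈ Finset.range j, b (k + i) - b (k + j) ∈ S (level k) := by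
    intro j
    induction j with
    | zero => intro k; simpa using hneg _ _ (hbS k)
    | succ j ih =>
      intro k
      have := hstep k _ (ih (k + 1))
      rw [Finset.sum_range_succ']
      have h1 : ∀ i, k + (i + 1) = k + 1 + i := fun i => by ring
      rw [Finset.sum_congr rfl fun i _ => congrArg b (h1 i), h1 j, add_zero]
      rwa [add_comm _ (b k), add_sub_assoc]
  have hpre : ∀ k, ∀ s ∈ S (level k), ∑ i ∈ Finset.range k, b i + s ∈ S N := by
    intro k
    induction k with
    | zero => intro s hs; rw [Finset.sum_range_zero, zero_add]; exact hs
    | succ k ih =>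
      intro s hs
      rw [Finset.sum_range_succ, add_assoc]
      exact ih _ (hstep k s hs)
  -- `level` is not known to be monotone, so the bound comes from 2s = (P + s) - (P - s), with P a
  -- prefix sum and both terms in `S N`.
  have hnorm : ∀ k, ∀ s ∈ S (level k), ‖s‖ ≤ μ := by
    intro k s hs
    have h1 := hle _ (hpre k s hs)
    have h2 := hle _ (hneg _ _ (hpre k (-s) (hneg _ _ hs)))
    have h3 : (2 : ℝ) • s = (∑ i ∈ Finset.range k, b i + s) - (∑ i ∈ Finset.range k, b i + -s) := by
      rw [two_smul]; abel
    have h4 := norm_sub_le (∑ i ∈ Finset.range k, b i + s) (∑ i ∈ Finset.range k, b i + -s)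
    rw [← h3, norm_smul, Real.norm_two] at h4
    rw [norm_neg] at h2
    linarith
  -- Differences are -(2b_k + t). As ‖4b_k‖ ≥ 3.6μ and ‖2b_k - t‖ ≤ 2μ, their norms are at least
  -- 1.6μ.
  have hκ : 16 / 10 * μ ≤ kottman X * μ := by
    refine le_kottman_mul_of_separated hμ0
      (y := fun k => ∑ i ∈ Finset.range k, b i - b k) (fun k => hle _ ?_) fun k l hkl => ?_
    · rw [sub_eq_add_neg]
      exact hpre k _ (hneg _ _ (hbS k))
    · obtain ⟨j, rfl⟩ := Nat.exists_eq_add_of_lt hkl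
      set t := ∑ i ∈ Finset.range j, b (k + 1 + i) - b (k + 1 + j) with ht
      have htS : t ∈ S (level (k + 1)) := hT j (k + 1)
      have h1 := hnorm k _ (hstep k (-t) (hneg _ _ htS))
      have h2 := hnorm k _ (hbS k)
      have heq : (∑ i ∈ Finset.range k, b i - b k) -
          (∑ i ∈ Finset.range (k + j + 1), b i - b (k + j + 1)) = -(b k + (b k + t)) := by
        have h3 : k + j + 1 = k + 1 + j := by ring
        rw [h3, Finset.sum_range_add, Finset.sum_range_succ, ht]
        abel
      rw [heq, norm_neg]
      have h4 : (4 : ℝ) • b k = (b k + (b k + t)) + (b k + (b k + -t)) := by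
        have : (4 : ℝ) = 1 + 1 + 1 + 1 := by norm_num
        rw [this, add_smul, add_smul, add_smul, one_smul]; abel
      have h5 := norm_add_le (b k + (b k + t)) (b k + (b k + -t))
      rw [← h4, norm_smul] at h5
      have h6 := norm_add_le (b k) (b k + -t)
      have h7 := hb9 k
      norm_num at h5
      linarith
  have := le_of_mul_le_mul_right hκ hμ0
  linarith

/-- A seminormalized sequence with bounded subset sums forces the Kottman constant to exceed
one. -/
theorem one_lt_kottman_of_bounded_sums {z : ℕ → X} {L δ : ℝ} (hδ : 0 < δ)
    (hz : ∀ n, δ ≤ ‖z n‖) (hL : ∀ F : Finset ℕ, ‖∑ i ∈ F, z i‖ ≤ L) : 1 < kottman X := by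
  classical
  refine one_lt_kottman_of_tails (δ := δ) (B := L + L)
    (S := fun n => {s | ∃ F G : Finset ℕ, Disjoint F G ∧ (∀ i ∈ F ∪ G, n ≤ i) ∧
      s = ∑ i ∈ F, z i - ∑ i ∈ G, z i}) ?_ ?_ ?_ ?_ hδ ?_
  · rintro m n hmn _ ⟨F, G, hFG, hn, rfl⟩
    exact ⟨F, G, hFG, fun i hi => hmn.trans (hn i hi), rfl⟩
  · rintro n _ ⟨F, G, hFG, hn, rfl⟩
    exact ⟨G, F, hFG.symm, by rwa [Finset.union_comm], by abel⟩
  · rintro n _ ⟨F, G, hFG, hn, rfl⟩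
    obtain ⟨m, hm⟩ := (F ∪ G).exists_nat_subset_range
    refine ⟨max m n, ?_⟩
    rintro _ ⟨F', G', hFG', hn', rfl⟩
    have hlt : ∀ i ∈ F ∪ G, ∀ j ∈ F' ∪ G', i ≠ j := by
      intro i hi j hj
      have h1 := Finset.mem_range.1 (hm hi)
      have h2 := (le_max_left m n).trans (hn' j hj)
      omega
    have hdis : ∀ {A B : Finset ℕ}, A ⊆ F ∪ G → B ⊆ F' ∪ G' → Disjoint A B := fun hA hB =>
      Finset.disjoint_left.2 fun i hi hi' => hlt i (hA hi) i (hB hi') rfl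
    have h1 : Disjoint F F' := hdis Finset.subset_union_left Finset.subset_union_left
    have h2 : Disjoint G G' := hdis Finset.subset_union_right Finset.subset_union_right
    have h3 : Disjoint F G' := hdis Finset.subset_union_left Finset.subset_union_right
    have h4 : Disjoint G F' := hdis Finset.subset_union_right Finset.subset_union_left
    refine ⟨F ∪ F', G ∪ G', ?_, ?_, ?_⟩
    · simp only [Finset.disjoint_union_left, Finset.disjoint_union_right]
      exact ⟨⟨hFG, h4.symm⟩, h3, hFG'⟩
    · intro i hi
      have : i ∈ F ∪ G ∨ i ∈ F' ∪ G' := by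
        simp only [Finset.mem_union] at hi ⊢
        tauto
      rcases this with h | h
      · exact hn i h
      · exact (le_max_right m n).trans (hn' i h)
    · rw [Finset.sum_union h1, Finset.sum_union h2]
      abel
  · rintro _ ⟨F, G, -, -, rfl⟩
    exact (norm_sub_le _ _).trans (add_le_add (hL F) (hL G))
  · exact fun n => ⟨z n, ⟨{n}, ∅, by simp, by simp, by simp⟩, hz n⟩

end NullSequences

/-! ### The Elton–Odell theorem. -/

section EltonOdell

variable {X : Type*} [NormedAddCommGroup X] [NormedSpace ℝ X]

/-- An infinite-dimensional space carries a seminormalized weakly null ultrafilter. -/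
theorem exists_weaklyNull_ultrafilter (hX : ¬ FiniteDimensional ℝ X) :
    ∃ (V : Ultrafilter X) (δ : ℝ), 0 < δ ∧ DropTo (V : Filter X) 0 ∧
      (∀ᶠ z in (V : Filter X), ‖z‖ ≤ 1) ∧ ∀ᶠ z in (V : Filter X), δ ≤ ‖z‖ := by
  obtain ⟨R, x, hR, hxR, hx⟩ := exists_seq_norm_le_one_le_norm_sub hX
  have hR0 : 0 < R := by linarith
  have hc : 0 < (2 * R)⁻¹ := by positivity
  let U : Ultrafilter ℕ := hyperfilter ℕ
  -- Each functional has a limit along `U`, so differences are weakly null even if the sequence has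
  -- no weak limit.
  let V : Ultrafilter X := U.bind fun m => U.map fun n => (2 * R)⁻¹ • (x m - x n)
  have hV : ∀ p : X → Prop, (∀ᶠ z in (V : Filter X), p z) ↔
      ∀ᶠ m in (U : Filter ℕ), ∀ᶠ n in (U : Filter ℕ), p ((2 * R)⁻¹ • (x m - x n)) :=
    fun p => Iff.rfl
  have hnorm : ∀ m n, ‖(2 * R)⁻¹ • (x m - x n)‖ = (2 * R)⁻¹ * ‖x m - x n‖ := fun m n => by
    rw [norm_smul, Real.norm_of_nonneg hc.le]
  refine ⟨V, (2 * R)⁻¹, hc, dropTo_of_weak fun f => ?_, ?_, ?_⟩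
  · rw [map_zero]
    obtain ⟨a, -, ha⟩ := (isCompact_Icc (a := -(‖f‖ * R)) (b := ‖f‖ * R)).ultrafilter_le_nhds
      (U.map fun n => f (x n)) (by
        rw [le_principal_iff]
        refine Eventually.of_forall (f := (U : Filter ℕ))
          (p := fun n => f (x n) ∈ Set.Icc (-(‖f‖ * R)) (‖f‖ * R)) fun n => ?_
        exact abs_le.1 ((f.le_opNorm _).trans
          (mul_le_mul_of_nonneg_left (hxR n) (norm_nonneg f))))
    have ha' : Tendsto (fun n => f (x n)) (U : Filter ℕ) (𝓝 a) := ha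
    rw [Metric.tendsto_nhds]
    intro ε hε
    rw [hV]
    have hball := ha'.eventually (Metric.ball_mem_nhds a (show 0 < R * ε by positivity))
    filter_upwards [hball] with m hm
    filter_upwards [hball] with n hn
    rw [map_smul, map_sub, dist_zero_right, smul_eq_mul, norm_mul, Real.norm_of_nonneg hc.le,
      ← dist_eq_norm]
    have h1 := (dist_triangle_right _ _ a).trans_lt (add_lt_add hm hn)
    have h2 := mul_lt_mul_of_pos_left h1 hc
    refine h2.trans_eq ?_
    field_simp
    norm_num
  · rw [hV]
    refine Eventually.of_forall fun m => Eventually.of_forall fun n => ?_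
    rw [hnorm, inv_mul_le_iff₀ (by positivity)]
    have := norm_sub_le (x m) (x n)
    linarith [hxR m, hxR n]
  · rw [hV]
    refine Eventually.of_forall fun m => ?_
    have : ∀ᶠ n in (U : Filter ℕ), n ≠ m := by
      have h := (Set.finite_singleton m).compl_mem_hyperfilter
      filter_upwards [h] with n hn
      simpa using hn
    filter_upwards [this] with n hn
    rw [hnorm]
    exact le_mul_of_one_le_right hc.le (hx hn.symm)

/-- **Elton–Odell theorem**: the Kottman constant of an infinite-dimensional space exceeds one. -/
theorem one_lt_kottman (hX : ¬ FiniteDimensional ℝ X) : 1 < kottman X := by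
  by_contra! hκ
  obtain ⟨V, δ, hδ, hV, hV1, hVδ⟩ := exists_weaklyNull_ultrafilter hX
  obtain ⟨L, hL⟩ := exists_not_exits hκ hV hV1
  obtain ⟨z, hz, hzL⟩ := exists_seq_bounded_sums hL hVδ
  exact absurd (one_lt_kottman_of_bounded_sums hδ hz hzL) (not_lt.2 hκ)

end EltonOdell

/-! ### Hölder extension into c₀. -/

section Holder

theorem dist_zeroAtInfty_le {f g : C₀(ℕ, ℝ)} {c : ℝ} (hc : 0 ≤ c) :
    dist f g ≤ c ↔ ∀ n, |f n - g n| ≤ c := by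
  rw [← ZeroAtInftyContinuousMap.dist_toBCF_eq_dist, BoundedContinuousFunction.dist_le hc]
  rfl

theorem tendsto_zeroAtInfty (f : C₀(ℕ, ℝ)) : Tendsto f atTop (𝓝 0) := by
  have := f.zero_at_infty'
  rwa [cocompact_eq_atTop] at this

/-- A real null sequence as an element of `C₀(ℕ, ℝ)`. -/
def ofTendsto (u : ℕ → ℝ) (hu : Tendsto u atTop (𝓝 0)) : C₀(ℕ, ℝ) where
  toFun := u
  continuous_toFun := continuous_of_discreteTopology
  zero_at_infty' := by rwa [cocompact_eq_atTop]

theorem holderWith_iff {X Y : Type*} [MetricSpace X] [MetricSpace Y] {C r : NNReal} {f : X → Y} :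
    HolderWith C r f ↔ ∀ x y, dist (f x) (f y) ≤ C * dist x y ^ (r : ℝ) := by
  have key : ∀ x y, edist (f x) (f y) ≤ C * edist x y ^ (r : ℝ) ↔
      dist (f x) (f y) ≤ C * dist x y ^ (r : ℝ) := by
    intro x y
    rw [edist_nndist, edist_nndist, ← ENNReal.coe_rpow_of_nonneg _ r.coe_nonneg, ← ENNReal.coe_mul,
      ENNReal.coe_le_coe, ← NNReal.coe_le_coe]
    simp
  exact forall₂_congr key

/-- A real function on `M` that is Lipschitz for the `α`-th power of the distance extends with a
larger constant, with values as close to zero as the constant permits. -/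
theorem exists_extension_near_zero {X : Type*} [MetricSpace X] {α K : ℝ} (hα : 0 < α) (hα1 : α ≤ 1)
    (hK : 0 ≤ K) {M : Set X} (hM : M.Nonempty) {f : M → ℝ}
    (hf : ∀ x y : M, |f x - f y| ≤ K * dist (x : X) y ^ α) :
    ∃ F : X → ℝ, (∀ x : M, F x = f x) ∧ (∀ x y, |F x - F y| ≤ K * dist x y ^ α) ∧
      ∀ x ε, 0 < ε → ε < |F x| → ∃ y : M, ε + K * dist x (y : X) ^ α < |f y| := by
  have := hM.to_subtype
  have htri : ∀ x y z : X, dist x z ^ α ≤ dist x y ^ α + dist y z ^ α := fun x y z =>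
    (Real.rpow_le_rpow dist_nonneg (dist_triangle x y z) hα.le).trans
      (Real.rpow_add_le_add_rpow dist_nonneg dist_nonneg hα.le hα1)
  let lo : X → ℝ := fun x => ⨆ y : M, (f y - K * dist x (y : X) ^ α)
  let up : X → ℝ := fun x => ⨅ y : M, (f y + K * dist x (y : X) ^ α)
  have hcross : ∀ (x : X) (y z : M), f y - K * dist x (y : X) ^ α ≤ f z + K * dist x (z : X) ^ α := by
    intro x y z
    have h1 := (abs_le.1 (hf y z)).2
    have h2 := mul_le_mul_of_nonneg_left (htri y x z) hK
    rw [dist_comm (y : X) x] at h2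
    linarith
  have hlobdd : ∀ x, BddAbove (Set.range fun y : M => f y - K * dist x (y : X) ^ α) := fun x => by
    obtain ⟨z⟩ := this
    exact ⟨_, by rintro _ ⟨y, rfl⟩; exact hcross x y z⟩
  have hupbdd : ∀ x, BddBelow (Set.range fun y : M => f y + K * dist x (y : X) ^ α) := fun x => by
    obtain ⟨z⟩ := this
    exact ⟨_, by rintro _ ⟨y, rfl⟩; exact hcross x z y⟩
  have hloup : ∀ x, lo x ≤ up x := fun x => ciSup_le fun y => le_ciInf fun z => hcross x y z
  have hlole : ∀ x (y : M), f y - K * dist x (y : X) ^ α ≤ lo x := fun x y => le_ciSup (hlobdd x) y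
  have huple : ∀ x (y : M), up x ≤ f y + K * dist x (y : X) ^ α := fun x y => ciInf_le (hupbdd x) y
  have hlolip : ∀ x x', lo x ≤ lo x' + K * dist x x' ^ α := fun x x' => ciSup_le fun y => by
    have h1 := hlole x' y
    have h2 := mul_le_mul_of_nonneg_left (htri x' x y) hK
    rw [dist_comm x' x] at h2
    linarith
  have huplip : ∀ x x', up x ≤ up x' + K * dist x x' ^ α := fun x x' => by
    rw [← sub_le_iff_le_add]
    refine le_ciInf fun y => ?_
    have h1 := huple x y
    have h2 := mul_le_mul_of_nonneg_left (htri x x' y) hK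
    linarith
  have hFlip : ∀ x x', max (lo x) (min (up x) 0) ≤ max (lo x') (min (up x') 0) + K * dist x x' ^ α := by
    intro x x'
    have h0 : 0 ≤ K * dist x x' ^ α := mul_nonneg hK (Real.rpow_nonneg dist_nonneg _)
    refine max_le ((hlolip x x').trans (by gcongr; exact le_max_left _ _)) ?_
    refine le_trans ?_ (add_le_add_left (le_max_right (lo x') (min (up x') 0)) _)
    rw [← min_add_add_right]
    exact min_le_min (huplip x x') (by linarith)
  -- As `lo ≤ up`, this is the median of `lo x`, `up x` and 0.
  refine ⟨fun x => max (lo x) (min (up x) 0), fun x => ?_, fun x y => ?_, fun x ε hε hx => ?_⟩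
  · have h0 : dist (x : X) x ^ α = 0 := by rw [dist_self, Real.zero_rpow hα.ne']
    have h1 := hlole x x
    have h2 := huple x x
    rw [h0, mul_zero] at h1 h2
    have h3 := hloup x
    have h4 : lo x = f x := by linarith
    have h5 : up x = f x := by linarith
    simp only [h4, h5]
    exact max_eq_left (min_le_left _ _)
  · rw [abs_le]
    have h1 := hFlip x y
    have h2 := hFlip y x
    rw [dist_comm y x] at h2
    constructor <;> linarith
  · rcases lt_abs.1 hx with h | h
    · have h1 : ε < lo x := by
        rcases lt_max_iff.1 h with h | h
        · exact h
        · linarith [min_le_right (up x) 0]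
      obtain ⟨y, hy⟩ := exists_lt_of_lt_ciSup h1
      exact ⟨y, lt_abs.2 (Or.inl (by linarith))⟩
    · have h1 : up x < -ε := by
        by_contra! h2
        have : -ε ≤ max (lo x) (min (up x) 0) := le_max_of_le_right (le_min h2 (by linarith))
        linarith
      obtain ⟨y, hy⟩ := exists_lt_of_ciInf_lt h1
      exact ⟨y, lt_abs.2 (Or.inr (by linarith))⟩

variable {X : Type*} [NormedAddCommGroup X]

/-- The extension constant for `α`-Hölder maps into `c₀` is at least `kottman X ^ α`. -/
theorem kottman_rpow_le_of_mem {C α : ℝ} (hC : 0 ≤ C)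
    (h : α ∈ holderExtExponents X C₀(ℕ, ℝ) C) : kottman X ^ α ≤ C := by
  classical
  obtain ⟨hα, hα1, hext⟩ := h
  have hαc : ((α.toNNReal : NNReal) : ℝ) = α := Real.coe_toNNReal _ hα.le
  by_contra! hlt
  rw [← Real.rpow_inv_lt_iff_of_pos hC (kottman_nonneg X) hα] at hlt
  obtain ⟨_, ⟨x, hx, rfl⟩, hs⟩ := exists_lt_of_lt_csSup (unitBallSeps_nonempty X) hlt
  set s := seqSep x
  have hs0 : 0 < s := (Real.rpow_nonneg hC _).trans_lt hs
  have hsC : C < s ^ α := (Real.rpow_inv_lt_iff_of_pos hC hs0.le hα).1 hs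
  have hsα : 0 ≤ s ^ α := Real.rpow_nonneg hs0.le _
  have hsep : ∀ m n, m ≠ n → s ≤ ‖x m - x n‖ := fun m n hmn =>
    ciInf_le (seqSep_bddBelow x) ⟨(m, n), hmn⟩
  have hinj : Function.Injective x := fun m n hmn => by
    by_contra hne
    have := hsep m n hne
    rw [hmn, sub_self, norm_zero] at this
    linarith
  have hnull : ∀ n : ℕ, Tendsto (Pi.single n (s ^ α) : ℕ → ℝ) atTop (𝓝 0) := fun n => by
    refine tendsto_const_nhds.congr' ?_
    filter_upwards [eventually_gt_atTop n] with k hk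
    rw [Pi.single_eq_of_ne hk.ne']
  let idx : Set.range x → ℕ := fun p => p.2.choose
  have hidx : ∀ p, x (idx p) = p := fun p => p.2.choose_spec
  have hidx' : ∀ n, idx ⟨x n, n, rfl⟩ = n := fun n => hinj (hidx _)
  let f : Set.range x → C₀(ℕ, ℝ) := fun p => ofTendsto _ (hnull (idx p))
  have hf : HolderWith 1 α.toNNReal f := by
    rw [holderWith_iff]
    intro p q
    rw [hαc, NNReal.coe_one, one_mul]
    refine (dist_zeroAtInfty_le (Real.rpow_nonneg dist_nonneg _)).2 fun n => ?_
    change |(Pi.single (idx p) (s ^ α) : ℕ → ℝ) n - (Pi.single (idx q) (s ^ α) : ℕ → ℝ) n| ≤ _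
    by_cases hpq : idx p = idx q
    · rw [hpq, sub_self, abs_zero]
      exact Real.rpow_nonneg dist_nonneg _
    · have h1 : s ^ α ≤ dist p q ^ α := by
        refine Real.rpow_le_rpow hs0.le ?_ hα.le
        rw [Subtype.dist_eq, ← hidx p, ← hidx q, dist_eq_norm]
        exact hsep _ _ hpq
      refine le_trans ?_ h1
      rw [Pi.single_apply, Pi.single_apply]
      split_ifs with h2 h3
      · exact absurd (h2.symm.trans h3) hpq
      · rw [sub_zero, abs_of_nonneg hsα]
      · rw [zero_sub, abs_neg, abs_of_nonneg hsα]
      · rwa [sub_zero, abs_zero]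
  obtain ⟨F, hFf, hF⟩ := hext _ f hf.memHolder
  have hFC : eHolderNorm α.toNNReal F ≤ ENNReal.ofReal C := by
    refine hF.trans ((mul_le_mul_right hf.eHolderNorm_le _).trans_eq ?_)
    rw [ENNReal.coe_one, mul_one]
  have hFm : MemHolder α.toNNReal F :=
    eHolderNorm_lt_top.1 (hFC.trans_lt ENNReal.ofReal_lt_top)
  have hFK : (nnHolderNorm α.toNNReal F : ℝ) ≤ C := by
    rw [← hFm.coe_nnHolderNorm_eq_eHolderNorm] at hFC
    exact (NNReal.coe_le_coe.2 (ENNReal.coe_le_coe.1 hFC)).trans_eq (Real.coe_toNNReal _ hC)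
  have hn : ∀ n, |s ^ α - F 0 n| ≤ C := by
    intro n
    have h1 := holderWith_iff.1 hFm.holderWith (x n) 0
    rw [hαc, dist_zero_right] at h1
    have h2 : dist (F (x n)) (F 0) ≤ C := by
      refine h1.trans ?_
      have h3 : ‖x n‖ ^ α ≤ 1 := Real.rpow_le_one (norm_nonneg _) (hx n) hα.le
      calc _ ≤ C * 1 := mul_le_mul hFK h3 (Real.rpow_nonneg (norm_nonneg _) _) hC
        _ = C := mul_one C
    have h3 := (dist_zeroAtInfty_le hC).1 h2 n
    have h4 : F (x n) n = s ^ α := by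
      rw [hFf ⟨x n, n, rfl⟩]
      change (Pi.single (idx ⟨x n, n, rfl⟩) (s ^ α) : ℕ → ℝ) n = s ^ α
      rw [hidx', Pi.single_eq_same]
    rwa [h4] at h3
  have hlim : Tendsto (fun n => |s ^ α - F 0 n|) atTop (𝓝 |s ^ α - 0|) :=
    ((tendsto_zeroAtInfty (F 0)).const_sub _).abs
  have := le_of_tendsto' hlim hn
  rw [sub_zero, abs_of_nonneg hsα] at this
  linarith

variable [NormedSpace ℝ X]

/-- No sequence in `X` has its distances to earlier terms exceed `kottman X` times its norms by a
fixed amount, when measured with the `α`-th power of the norm. -/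
theorem not_exists_seq_gap (hκ : 1 < kottman X) {α : ℝ} (hα : 0 < α) (hα1 : α ≤ 1) {ε : ℝ}
    (hε : 0 < ε) {y : ℕ → X}
    (hy : ∀ m n, m < n → ε + kottman X ^ α * ‖y n‖ ^ α ≤ ‖y m - y n‖ ^ α) : False := by
  set κ := kottman X
  have hκ0 : 0 < κ := by linarith
  have hκα : 1 < κ ^ α := Real.one_lt_rpow hκ hα
  -- Comparison with `y 0` bounds (κ^α - 1)‖y n‖^α by ‖y 0‖^α.
  obtain ⟨R, hR⟩ : ∃ R, ∀ n, ‖y n‖ ≤ R := by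
    refine ⟨max ‖y 0‖ ((‖y 0‖ ^ α / (κ ^ α - 1)) ^ α⁻¹), fun n => ?_⟩
    rcases Nat.eq_zero_or_pos n with rfl | hn
    · exact le_max_left _ _
    · refine le_max_of_le_right ?_
      rw [Real.le_rpow_inv_iff_of_pos (norm_nonneg _)
        (div_nonneg (Real.rpow_nonneg (norm_nonneg _) _) (by linarith)) hα,
        le_div_iff₀ (by linarith)]
      have h1 := hy 0 n hn
      have h2 : ‖y 0 - y n‖ ^ α ≤ ‖y 0‖ ^ α + ‖y n‖ ^ α :=
        (Real.rpow_le_rpow (norm_nonneg _) (norm_sub_le _ _) hα.le).trans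
          (Real.rpow_add_le_add_rpow (norm_nonneg _) (norm_nonneg _) hα.le hα1)
      linarith
  obtain ⟨r, hr, φ, hφ, hlim⟩ := (isCompact_Icc (a := (0 : ℝ)) (b := R)).tendsto_subseq
    (x := fun n => ‖y n‖) fun n => ⟨norm_nonneg _, hR n⟩
  have hlim1 : Tendsto (fun n => ε + κ ^ α * ‖y (φ n)‖ ^ α) atTop (𝓝 (ε + κ ^ α * r ^ α)) :=
    ((hlim.rpow_const (Or.inr hα.le)).const_mul _).const_add _
  have hcont : Tendsto (fun b : ℝ => (κ * b) ^ α) (𝓝[>] r) (𝓝 ((κ * r) ^ α)) :=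
    (((continuous_const.mul continuous_id).tendsto r).rpow_const (Or.inr hα.le)).mono_left
      nhdsWithin_le_nhds
  have hlt : (κ * r) ^ α < ε + κ ^ α * r ^ α := by
    rw [Real.mul_rpow hκ0.le hr.1]; linarith
  -- Taking `b > r` gives a positive radius even when `r = 0`.
  obtain ⟨b, hb1, hb⟩ := ((hcont.eventually (gt_mem_nhds hlt)).and self_mem_nhdsWithin).exists
  have hb0 : 0 < b := hr.1.trans_lt hb
  obtain ⟨v, hv1, hv2⟩ := exists_between hb1
  have hκb : 0 ≤ κ * b := (mul_pos hκ0 hb0).le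
  have hv0 : 0 ≤ v := (Real.rpow_nonneg hκb α).trans hv1.le
  obtain ⟨N, hN⟩ := ((hlim.eventually (gt_mem_nhds hb)).and
    (hlim1.eventually (lt_mem_nhds hv2))).exists_forall_of_atTop
  refine absurd (le_kottman_mul_of_separated hb0 (y := fun n => y (φ (N + n))) (c := v ^ α⁻¹)
    (fun n => (hN _ (Nat.le_add_right _ _)).1.le) fun m n hmn => ?_)
    (not_le.2 ((Real.lt_rpow_inv_iff_of_pos hκb hv0 hα).2 hv1))
  rw [Real.rpow_inv_le_iff_of_pos hv0 (norm_nonneg _) hα]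
  exact (hN (N + n) (Nat.le_add_right _ _)).2.le.trans (hy _ _ (hφ (by omega)))

/-- Hölder maps into `c₀` extend with the constant `kottman X ^ α`. -/
theorem exists_holder_extension (hκ : 1 < kottman X) {α : ℝ} (hα : 0 < α) (hα1 : α ≤ 1)
    (M : Set X) (f : M → C₀(ℕ, ℝ)) (hf : MemHolder α.toNNReal f) :
    ∃ F : X → C₀(ℕ, ℝ), (∀ x : M, F x = f x) ∧
      eHolderNorm α.toNNReal F ≤ ENNReal.ofReal (kottman X ^ α) * eHolderNorm α.toNNReal f := by
  rcases M.eq_empty_or_nonempty with rfl | hM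
  · exact ⟨0, fun x => absurd x.2 (Set.notMem_empty _), by simp [eHolderNorm_zero]⟩
  have hκα : 1 < kottman X ^ α := Real.one_lt_rpow hκ hα
  set K := nnHolderNorm α.toNNReal f with hKdef
  have hαc : ((α.toNNReal : NNReal) : ℝ) = α := Real.coe_toNNReal _ hα.le
  have hfK : ∀ n, ∀ x y : M, |f x n - f y n| ≤ K * dist (x : X) y ^ α := by
    intro n x y
    have h := holderWith_iff.1 hf.holderWith x y
    rw [hαc] at h
    exact (dist_zeroAtInfty_le (mul_nonneg K.2 (Real.rpow_nonneg dist_nonneg _))).1 h n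
  have hΛ : (0 : ℝ) ≤ kottman X ^ α * K := mul_nonneg (by linarith) K.2
  have hext := fun n => exists_extension_near_zero hα hα1 hΛ hM (f := fun x => f x n)
    fun x y => (hfK n x y).trans (mul_le_mul_of_nonneg_right
      (le_mul_of_one_le_left K.2 hκα.le) (Real.rpow_nonneg dist_nonneg _))
  choose F hFf hFlip hFnear using hext
  have hF0 : ∀ x, Tendsto (fun n => F n x) atTop (𝓝 0) := by
    intro x
    rw [Metric.tendsto_nhds]
    by_contra! hcon
    obtain ⟨ε, hε, hfreq⟩ := hcon
    have hfreq' : ∃ᶠ n in atTop, ∃ y : M, ε / 2 + kottman X ^ α * K * dist x (y : X) ^ α < |f y n| := by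
      refine hfreq.mono fun n hn => hFnear n x (ε / 2) (by linarith) ?_
      rw [Real.dist_0_eq_abs] at hn
      linarith
    -- Each chosen coordinate is large at its own point and small at all earlier points, which
    -- pushes the points apart.
    obtain ⟨g, hg, hg'⟩ := exists_seq_of_forall_finset_exists
      (fun p : ℕ × M => ε / 2 + kottman X ^ α * K * dist x (p.2 : X) ^ α < |f p.2 p.1|)
      (fun p p' => |f p.2 p'.1| < ε / 4) (by
        intro s _
        have h : ∀ᶠ n in atTop, ∀ p ∈ s, |f p.2 n| < ε / 4 := by
          refine (eventually_all_finset s).2 fun p _ => ?_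
          have h := (Metric.tendsto_nhds.1 (tendsto_zeroAtInfty (f p.2))) (ε / 4) (by linarith)
          simpa only [Real.dist_0_eq_abs] using h
        obtain ⟨n, ⟨y, hy⟩, hn⟩ := (hfreq'.and_eventually h).exists
        exact ⟨(n, y), hy, hn⟩)
    have hgap : ∀ m n, m < n → ε / 4 + kottman X ^ α * K * dist x ((g n).2 : X) ^ α ≤
        K * dist ((g m).2 : X) (g n).2 ^ α := by
      intro m n hmn
      have h1 := hg n
      have h2 := hg' m n hmn
      have h3 := hfK (g n).1 (g n).2 (g m).2
      have h4 := abs_sub_abs_le_abs_sub (f (g n).2 (g n).1) (f (g m).2 (g n).1)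
      rw [dist_comm] at h3
      linarith
    have hK0 : (0 : ℝ) < K := by
      refine lt_of_le_of_ne K.2 fun h => ?_
      have := hgap 0 1 one_pos
      change (0 : ℝ) = (K : ℝ) at h
      rw [← h] at this
      linarith
    refine not_exists_seq_gap hκ hα hα1 (ε := ε / 4 / K) (by positivity)
      (y := fun n => ((g n).2 : X) - x) fun m n hmn => ?_
    have h := hgap m n hmn
    rw [sub_sub_sub_cancel_right, ← dist_eq_norm, ← dist_eq_norm, dist_comm _ x]
    refine le_of_mul_le_mul_left (le_trans (le_of_eq ?_) h) hK0
    field_simp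
  refine ⟨fun x => ofTendsto (fun n => F n x) (hF0 x), fun x => ?_, ?_⟩
  · ext n
    exact hFf n x
  · have hH : HolderWith ((kottman X ^ α).toNNReal * K) α.toNNReal
        fun x => ofTendsto (fun n => F n x) (hF0 x) := by
      rw [holderWith_iff]
      intro x y
      rw [NNReal.coe_mul, Real.coe_toNNReal _ (by linarith), hαc]
      exact (dist_zeroAtInfty_le (mul_nonneg hΛ (Real.rpow_nonneg dist_nonneg _))).2
        fun n => hFlip n x y
    refine hH.eHolderNorm_le.trans_eq ?_
    rw [ENNReal.coe_mul, hf.coe_nnHolderNorm_eq_eHolderNorm]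
    rfl

/-- The exponents with extension constant `C` are those with `kottman X ^ α ≤ C`. -/
theorem mem_holderExtExponents_iff (hκ : 1 < kottman X) {C α : ℝ} (hC : 0 ≤ C) :
    α ∈ holderExtExponents X C₀(ℕ, ℝ) C ↔ 0 < α ∧ α ≤ 1 ∧ kottman X ^ α ≤ C := by
  refine ⟨fun h => ⟨h.1, h.2.1, kottman_rpow_le_of_mem hC h⟩, fun ⟨hα, hα1, hle⟩ =>
    ⟨hα, hα1, fun M f hf => ?_⟩⟩
  obtain ⟨F, hF, hF'⟩ := exists_holder_extension hκ hα hα1 M f hf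
  exact ⟨F, hF, hF'.trans (mul_le_mul_left (ENNReal.ofReal_le_ofReal hle) _)⟩

end Holder

end Kottman

theorem mainTheorem4 {X : Type*} [NormedAddCommGroup X] [NormedSpace ℝ X] [CompleteSpace X]
    (hX : ¬ FiniteDimensional ℝ X) :
    1 < kottman X ∧
    (∀ C : ℝ, 1 ≤ C → C ≤ kottman X →
      holderExtExponents X C₀(ℕ, ℝ) C = Set.Ioc 0 (Real.log C / Real.log (kottman X))) ∧
    (∀ α : ℝ, 0 < α → α ≤ 1 →
      holderExtExponents X C₀(ℕ, ℝ) (kottman X ^ α) = Set.Ioc 0 α) := by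
  have hκ := Kottman.one_lt_kottman hX
  have hκ0 : 0 < kottman X := by linarith
  have hlog : 0 < Real.log (kottman X) := Real.log_pos hκ
  refine ⟨hκ, fun C hC hCκ => ?_, fun α hα hα1 => ?_⟩
  · ext β
    have hC0 : 0 < C := by linarith
    have key : kottman X ^ β ≤ C ↔ β ≤ Real.log C / Real.log (kottman X) := by
      rw [Real.rpow_le_iff_le_log hκ0 hC0, le_div_iff₀ hlog]
    rw [Kottman.mem_holderExtExponents_iff hκ hC0.le, Set.mem_Ioc, key]
    refine ⟨fun h => ⟨h.1, h.2.2⟩, fun h => ⟨h.1, h.2.trans ?_, h.2⟩⟩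
    -- `C ≤ kottman X` is what makes the upper endpoint at most 1.
    exact (div_le_one hlog).2 (Real.log_le_log hC0 hCκ)
  · ext β
    rw [Kottman.mem_holderExtExponents_iff hκ (Real.rpow_nonneg hκ0.le _), Set.mem_Ioc,
      Real.rpow_le_rpow_left_iff hκ]
    exact ⟨fun h => ⟨h.1, h.2.2⟩, fun h => ⟨h.1, h.2.trans hα1, h.2⟩⟩
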